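/- **Setting.** Let $(\Delta,\mathfrak D,\mathbb P)$ be a probability space, $\mathcal Z$ a set of decisions, $m\ge 1$ an integer, and for each criterion $i=1,\dots,m$ and each $\delta\in\Delta$ let $\mathcal Z_i(\delta)\subseteq\mathcal Z$ be the set of decisions that are appropriate for criterion $i$ under $\delta$. The joint risk of $z\in\mathcal Z$ is $$V(z)=\mathbb P\{\delta\in\Delta:\ z\notin\mathcal Z_i(\delta)\ \text{for some } i\}.$$ A decision scheme $\mathcal M$ assigns a decision to every $m$-tuple $\boldsymbol{\mathcal D}=(\mathcal D_1,\dots,\mathcal D_m)$ of finite lists of elements of $\Delta$ (scenarios). (It is defined on empty lists too, so that scenarios can be removed; it is understood that for each fixed choice of list lengths $N_i\ge1$ the set of pairs $(\boldsymbol{\mathcal D},\delta)$ with $\mathcal M(\boldsymbol{\mathcal D})\in\mathcal Z_i(\delta)$ is measurable.) A scenario of $\mathcal D_i$ is a support scenario of $\boldsymbol{\mathcal D}$ if removing it, while keeping all the others, changes the decision. Let $\mathcal S_i$ be the sub-list of support scenarios in $\mathcal D_i$, $\boldsymbol{\mathcal S}=(\mathcal S_1,\dots,\mathcal S_m)$,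 and let $|\boldsymbol s^\star|=\sum_i|\mathcal S_i|$ be the total number of support scenarios. For $\boldsymbol N=(N_1,\dots,N_m)$ with all $N_i\ge 1$, write $|\boldsymbol N|=\sum_iN_i$ and let $\mathbb P^{|\boldsymbol N|}$ be the law of $\boldsymbol{\mathcal D}$ when $|\mathcal D_i|=N_i$ and all scenarios are independent with law $\mathbb P$. **Assumptions.** For all nonempty lists $\mathcal D_1,\dots,\mathcal D_m$ and all (possibly empty) lists $\widetilde{\mathcal D}_1,\dots,\widetilde{\mathcal D}_m$, with $\mathcal D_i^+$ the concatenation of $\mathcal D_i$ and $\widetilde{\mathcal D}_i$: 1. (permutation invariance) $\mathcal M(\boldsymbol{\mathcal D})$ does not change if the elements of each $\mathcal D_i$ are permuted; 2. (stability) if $\mathcal M(\boldsymbol{\mathcal D})\in\mathcal Z_i(\delta)$ for all $i$ and all $\delta\in\widetilde{\mathcal D}_i$, then $\mathcal M(\mathcal D_1^+,\dots,\mathcal D_m^+)=\mathcal M(\boldsymbol{\mathcal D})$; 3. (responsiveness) if $\mathcal M(\boldsymbol{\mathcal D})\notin\mathcal Z_i(\delta)$ for some $i$ and some $\delta\in\widetilde{\mathcal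 D}_i$, then $\mathcal M(\mathcal D_1^+,\dots,\mathcal D_m^+)\ne\mathcal M(\boldsymbol{\mathcal D})$. Moreover, for every $\boldsymbol N$ with all $N_i\ge1$: 4. (non-degeneracy) $\mathcal M(\boldsymbol{\mathcal S})=\mathcal M(\boldsymbol{\mathcal D})$ with $\mathbb P^{|\boldsymbol N|}$-probability one; 5. (bounded complexity) $|\boldsymbol s^\star|\le K$ for every $\boldsymbol{\mathcal D}$, where $K\ge0$ is a fixed integer. **Statement.** Let $N_1,\dots,N_m\ge 1$, $\underline N=\min_iN_i$ and $\beta\in(0,1)$. If $K<\underline N$, let $\bar t_K$ be the unique positive zero (it lies in $(0,1)$) of $$\psi(t)=1-\frac{\beta}{\underline N}\sum_{j=1}^{\underline N-K}\frac{\binom{\underline N-j}{K}}{\binom{\underline N}{K}}\,t^{-j};$$ otherwise let $\bar t_K=0$. Then $z^\star_{\boldsymbol N}=\mathcal M(\boldsymbol{\mathcal D})$ satisfies $$\mathbb P^{|\boldsymbol N|}\Big\{V(z^\star_{\boldsymbol N})\le\min\big\{\log\tfrac1{\bar t_K},\,1\big\}\Big\}\ \ge\ 1-\beta,$$ where the minimum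 is read as $1$ when $\bar t_K=0$. The bound depends only on $\beta$, $K$ and $\underline N$; in particular it is uniform in the number $m$ of criteria. -/

import Mathlib

namespace MultiCriteria

open MeasureTheory Set

section Scheme

variable {m : ℕ} {Δ Z : Type*}

/-- Datasets are families `D : Fin m → List Δ`; the position `i` of the list `D i` is the label
telling for which criterion its scenarios were collected. A decision scheme is a map
`M : (Fin m → List Δ) → Z`. It is defined on empty lists as well, since the removal of a scenario
may leave an empty dataset.

`Zi i δ` is the set of decisions that are appropriate for criterion `i` under `δ`.
Permutation invariance, stability in case of confirmation and responsiveness to contradiction are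
required for nonempty datasets `D i`, the lists `E i` of additional scenarios being arbitrary. -/
structure IsConsistent (M : (Fin m → List Δ) → Z) (Zi : Fin m → Δ → Set Z) : Prop where
  perm_invariant : ∀ D D' : Fin m → List Δ, (∀ i, D i ≠ []) →
    (∀ i, (D' i).Perm (D i)) → M D' = M D
  stable : ∀ D E : Fin m → List Δ, (∀ i, D i ≠ []) →
    (∀ i, ∀ δ ∈ E i, M D ∈ Zi i δ) → M (fun i => D i ++ E i) = M D
  responsive : ∀ D E : Fin m → List Δ, (∀ i, D i ≠ []) →
    (∃ i, ∃ δ ∈ E i, M D ∉ Zi i δ) → M (fun i => D i ++ E i) ≠ M D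

/-- The datasets obtained by removing the `j`-th scenario of the `i`-th dataset. -/
def remove (D : Fin m → List Δ) (i : Fin m) (j : ℕ) : Fin m → List Δ :=
  Function.update D i ((D i).eraseIdx j)

/-- The `j`-th scenario of the `i`-th dataset is a support scenario: its removal changes the
decision. -/
def IsSupport (M : (Fin m → List Δ) → Z) (D : Fin m → List Δ) (i : Fin m)
    (j : Fin (D i).length) : Prop :=
  M (remove D i j) ≠ M D

open Classical in
/-- The sub-list of the support scenarios of the `i`-th dataset, with repetitions. -/
noncomputable def supportList (M : (Fin m → List Δ) → Z) (D : Fin m → List Δ) (i : Fin m) :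
    List Δ :=
  ((List.finRange (D i).length).filter (fun j => IsSupport M D i j)).map (D i).get

/-- The complexity: the vector of the numbers of support scenarios. -/
noncomputable def complexity (M : (Fin m → List Δ) → Z) (D : Fin m → List Δ) (i : Fin m) : ℕ :=
  (supportList M D i).length

/-- The lists of scenarios that correspond to a point of `Δ ^ N₁ × ⋯ × Δ ^ Nₘ`. -/
def toLists {N : Fin m → ℕ} (x : (i : Fin m) → Fin (N i) → Δ) : Fin m → List Δ :=
  fun i => List.ofFn (x i)

variable [MeasurableSpace Δ]

/-- The law of the datasets: the product of `N₁ + ⋯ + Nₘ` copies of `P`. -/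
noncomputable def dataLaw (P : Measure Δ) (N : Fin m → ℕ) :
    Measure ((i : Fin m) → Fin (N i) → Δ) :=
  Measure.pi fun i => Measure.pi fun _ : Fin (N i) => P

/-- The joint risk of a decision `z`. -/
noncomputable def jointRisk (P : Measure Δ) (Zi : Fin m → Δ → Set Z) (z : Z) : ℝ :=
  P.real {δ | ∃ i, z ∉ Zi i δ}

/-- The measurability that is needed to speak of the risk of the decision as a random variable:
the event that a fresh `δ` confirms the decision for criterion `i` is measurable in `(D, δ)`. -/
def IsMeasurableScheme (M : (Fin m → List Δ) → Z) (Zi : Fin m → Δ → Set Z) : Prop :=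
  ∀ N : Fin m → ℕ, (∀ i, 0 < N i) → ∀ i : Fin m,
    MeasurableSet {p : ((i : Fin m) → Fin (N i) → Δ) × Δ | M (toLists p.1) ∈ Zi i p.2}

/-- Non-degeneracy: with probability one the support scenarios alone give back the decision. -/
def IsNonDegenerate (P : Measure Δ) (M : (Fin m → List Δ) → Z) : Prop :=
  ∀ N : Fin m → ℕ, (∀ i, 0 < N i) →
    ∀ᵐ x ∂(dataLaw P N), M (supportList M (toLists x)) = M (toLists x)

/-- The total number of support scenarios never exceeds `K`. -/
def HasComplexityAtMost (M : (Fin m → List Δ) → Z) (K : ℕ) : Prop :=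
  ∀ N : Fin m → ℕ, (∀ i, 0 < N i) →
    ∀ x : (i : Fin m) → Fin (N i) → Δ, ∑ i, complexity M (toLists x) i ≤ K

end Scheme

section Threshold

/-- `ψ(t) = 1 - (β / n) ∑_{j = 1}^{n - K} (n - j choose K) / (n choose K) t⁻ʲ`. -/
noncomputable def psi (β : ℝ) (K n : ℕ) (t : ℝ) : ℝ :=
  1 - β / n * ∑ j ∈ Finset.Icc 1 (n - K),
    ((n - j).choose K : ℝ) / (n.choose K : ℝ) * t ^ (-(j : ℤ))

/-- The unique positive zero of `psi β K n` if `K < n` (see `tbar_spec`), and `0` otherwise. -/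
noncomputable def tbar (β : ℝ) (K n : ℕ) : ℝ :=
  if K < n then Classical.epsilon (fun t : ℝ => 0 < t ∧ psi β K n t = 0) else 0

theorem psi_strictMonoOn {β : ℝ} {K n : ℕ} (hβ : 0 < β) (hK : K < n) :
    StrictMonoOn (psi β K n) (Ioi 0) := by
  intro s hs t ht hst
  have hs' : (0 : ℝ) < s := hs
  have hn : (0 : ℝ) < n := by exact_mod_cast (Nat.zero_le K).trans_lt hK
  unfold psi
  apply sub_lt_sub_left
  apply mul_lt_mul_of_pos_left _ (div_pos hβ hn)
  apply Finset.sum_lt_sum_of_nonempty ⟨1, Finset.mem_Icc.2 ⟨le_refl _, by omega⟩⟩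
  intro j hj
  rw [Finset.mem_Icc] at hj
  have h1 : 0 < (n - j).choose K := Nat.choose_pos (by omega)
  have h2 : 0 < n.choose K := Nat.choose_pos hK.le
  apply mul_lt_mul_of_pos_left _ (by positivity)
  rw [zpow_neg, zpow_neg, zpow_natCast, zpow_natCast]
  exact inv_strictAnti₀ (by positivity) (pow_lt_pow_left₀ hst hs'.le (by omega))

theorem exists_zero_psi {β : ℝ} {K n : ℕ} (hβ : 0 < β) (hβ1 : β < 1) (hK : K < n) :
    ∃ t ∈ Ioo (0 : ℝ) 1, psi β K n t = 0 := by
  have hn : (0 : ℝ) < n := by exact_mod_cast (Nat.zero_le K).trans_lt hK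
  have hc : 0 < n.choose K := Nat.choose_pos hK.le
  have hcR : (0 : ℝ) < n.choose K := by exact_mod_cast hc
  have h1 : 0 < psi β K n 1 := by
    have hsum : ∑ j ∈ Finset.Icc 1 (n - K),
        ((n - j).choose K : ℝ) / (n.choose K : ℝ) * (1 : ℝ) ^ (-(j : ℤ)) ≤ n := by
      calc _ ≤ ∑ j ∈ Finset.Icc 1 (n - K), (1 : ℝ) := by
            apply Finset.sum_le_sum
            intro j _
            rw [one_zpow, mul_one, div_le_one hcR]
            exact_mod_cast Nat.choose_le_choose K (Nat.sub_le n j)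
        _ ≤ n := by simp
    have : β / n * ∑ j ∈ Finset.Icc 1 (n - K),
        ((n - j).choose K : ℝ) / (n.choose K : ℝ) * (1 : ℝ) ^ (-(j : ℤ)) ≤ β := by
      calc _ ≤ β / n * n := by gcongr
        _ = β := by field_simp
    unfold psi
    linarith
  set a : ℝ := β / (n * n.choose K) with ha
  have ha0 : 0 < a := by positivity
  have hn1 : (1 : ℝ) ≤ n := by exact_mod_cast (show 1 ≤ n by omega)
  have hc1 : (1 : ℝ) ≤ n.choose K := by exact_mod_cast hc
  have ha1 : a ≤ 1 := by
    rw [ha, div_le_one (by positivity)]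
    nlinarith
  have h0 : psi β K n a ≤ 0 := by
    have hsum : ((n - 1).choose K : ℝ) / (n.choose K : ℝ) * a ^ (-((1 : ℕ) : ℤ)) ≤
        ∑ j ∈ Finset.Icc 1 (n - K),
          ((n - j).choose K : ℝ) / (n.choose K : ℝ) * a ^ (-(j : ℤ)) := by
      apply Finset.single_le_sum
        (f := fun j : ℕ => ((n - j).choose K : ℝ) / (n.choose K : ℝ) * a ^ (-(j : ℤ)))
      · intro j _
        positivity
      · exact Finset.mem_Icc.2 ⟨le_refl _, by omega⟩
    have hd : (1 : ℝ) ≤ (n - 1).choose K := by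
      exact_mod_cast Nat.choose_pos (show K ≤ n - 1 by omega)
    have : 1 ≤ β / n * (((n - 1).choose K : ℝ) / (n.choose K : ℝ) * a ^ (-((1 : ℕ) : ℤ))) := by
      have e : β / n * (((n - 1).choose K : ℝ) / (n.choose K : ℝ) * a ^ (-((1 : ℕ) : ℤ)))
          = (n - 1).choose K := by
        rw [Nat.cast_one, zpow_neg_one, ha]
        field_simp
      rw [e]
      exact hd
    have h3 := mul_le_mul_of_nonneg_left hsum (div_pos hβ hn).le
    unfold psi
    linarith
  have hcont : ContinuousOn (psi β K n) (Icc a 1) := by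
    unfold psi
    refine continuousOn_const.sub (continuousOn_const.mul (continuousOn_finsetSum _ ?_))
    intro j _
    refine continuousOn_const.mul (continuousOn_id.zpow₀ _ ?_)
    intro x hx
    exact Or.inl (ha0.trans_le hx.1).ne'
  obtain ⟨t, ht, ht0⟩ := intermediate_value_Icc ha1 hcont ⟨h0, h1.le⟩
  refine ⟨t, ⟨ha0.trans_le ht.1, lt_of_le_of_ne ht.2 ?_⟩, ht0⟩
  rintro rfl
  exact h1.ne' ht0

/-- `tbar β K n` is well-defined: for `K < n` it is the only positive zero of `psi β K n`, and it
lies in `(0, 1)`. -/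
theorem tbar_spec {β : ℝ} {K n : ℕ} (hβ : 0 < β) (hβ1 : β < 1) (hK : K < n) :
    tbar β K n ∈ Ioo (0 : ℝ) 1 ∧ psi β K n (tbar β K n) = 0 ∧
      ∀ t : ℝ, 0 < t → psi β K n t = 0 → t = tbar β K n := by
  obtain ⟨t, ht, ht0⟩ := exists_zero_psi hβ hβ1 hK
  have hz : 0 < tbar β K n ∧ psi β K n (tbar β K n) = 0 := by
    unfold tbar
    rw [if_pos hK]
    exact Classical.epsilon_spec (p := fun t : ℝ => 0 < t ∧ psi β K n t = 0) ⟨t, ht.1, ht0⟩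
  have huniq : ∀ s : ℝ, 0 < s → psi β K n s = 0 → s = tbar β K n := fun s hs hs0 =>
    (psi_strictMonoOn hβ hK).injOn hs hz.1 (hs0.trans hz.2.symm)
  exact ⟨huniq t ht.1 ht0 ▸ ht, hz.2, huniq⟩

/-- `min {log (1 / t), 1}`, read as `1` for `t = 0`. -/
noncomputable def logBound (t : ℝ) : ℝ :=
  if t = 0 then 1 else min (Real.log (1 / t)) 1

end Threshold

end MultiCriteria

/-! Let `T` be the probability that independent fresh scenarios, one per criterion, all confirm the
decision. The union bound and `1 - u ≤ exp (-u)` give `T ≤ exp (-V)` for every `m`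
(`confirmProb_le_exp_neg_jointRisk`), so it suffices that `T < t` has probability at most `β`, where
`t` is the zero of `psi`.

This follows from negative moments of `T`. Discard `j` scenarios from each dataset. By stability and
responsiveness, the selected ones reproduce the full decision exactly when every discarded scenario
confirms theirs. Given the selected ones this has probability `T ^ j`, so `T⁻¹ ^ j` integrates to at
most 1 over that event (`lintegral_indicator_confirmProb_le`). On the other hand, for every sample
at least the fraction `r j = (n - j choose K) / (n choose K)` of the selections reproduce the
decision (`ratio_mul_le_goodCount`), with `n` the least dataset size. Summing over selections, `r j
* E[T⁻¹ ^ j] ≤ 1`. Since `psi` vanishes at `t`, `∑ r j * t⁻¹ ^ j = n / β`, and Markov's inequality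
for `∑ r j * T⁻¹ ^ j` concludes.

The fraction is pure combinatorics. The reproducing selections form an upward closed family, and the
elements that cannot be removed from a member are support scenarios, at most `K` in all. Deleting
removable elements one at a time and double counting gives a product of binomials with `∑ k i ≤ K`
(`exists_prod_choose_le_goodCount`). The worst case puts all of `K` in one dataset of size `n`
(`choose_ratio_le_prod`). -/

namespace MultiCriteria

open Finset Function

/-! ### Counting members of an upward closed family of selections -/

section Subfamilies

variable {ι : Type*} {α : ι → Type*} (F : (∀ i, Finset (α i)) → Prop)

section Erase

variable [DecidableEq ι] [∀ i, DecidableEq (α i)]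

/-- The family obtained from `J` by removing `l` from its `i`-th member. -/
def eraseAt (J : ∀ i, Finset (α i)) (i : ι) (l : α i) : ∀ i, Finset (α i) :=
  update J i ((J i).erase l)

@[simp]
theorem eraseAt_self (J : ∀ i, Finset (α i)) (i : ι) (l : α i) :
    eraseAt J i l i = (J i).erase l := by
  simp [eraseAt]

theorem eraseAt_of_ne (J : ∀ i, Finset (α i)) {i i' : ι} (h : i' ≠ i) (l : α i) :
    eraseAt J i l i' = J i' := by
  simp [eraseAt, h]

theorem eraseAt_subset (J : ∀ i, Finset (α i)) (i : ι) (l : α i) (i' : ι) :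
    eraseAt J i l i' ⊆ J i' := by
  by_cases h : i' = i
  · subst h
    simpa using erase_subset l _
  · rw [eraseAt_of_ne J h]

open Classical in
/-- The elements of `J i` that cannot be removed from `J` without leaving `F`, provided that they
are not the only ones of their group. -/
noncomputable def essential (J : ∀ i, Finset (α i)) (i : ι) : Finset (α i) :=
  {l ∈ J i | 1 < #(J i) ∧ ¬ F (eraseAt J i l)}

variable {F} in
-- By upward closure, an element that cannot be removed from `J` cannot be removed from anything
-- smaller, so essential elements survive the deletion of an inessential one. The one exception is a
-- group shrinking from two elements to one, where the guard `1 < #(J i)` empties the essential set;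
-- `hi2` rules out a loss there.
theorem card_essential_le_eraseAt {J : ∀ i, Finset (α i)}
    (hup : ∀ J J' : ∀ i, Finset (α i), (∀ i, (J i).Nonempty) → (∀ i, J i ⊆ J' i) → F J → F J')
    (hne : ∀ i, (J i).Nonempty) {i : ι} (hi : 1 < #(J i))
    (hi2 : #(J i) = 2 → essential F J i = ∅) {l : α i} (hl : l ∈ J i) (hle : l ∉ essential F J i)
    (i' : ι) : #(essential F J i') ≤ #(essential F (eraseAt J i l) i') := by
  classical
  have hFl : F (eraseAt J i l) := by
    by_contra h
    exact hle (mem_filter.2 ⟨hl, hi, h⟩)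
  by_cases h2 : i' = i ∧ #(J i) = 2
  · obtain ⟨rfl, h2⟩ := h2
    simp [hi2 h2]
  apply card_le_card
  intro l' hl'
  obtain ⟨hl'J, hi', hF'⟩ := mem_filter.1 hl'
  have hcard : 1 < #(eraseAt J i l i') := by
    by_cases h : i' = i
    · subst h
      rw [eraseAt_self, card_erase_of_mem hl]
      have : #(J i') ≠ 2 := fun h => h2 ⟨rfl, h⟩
      omega
    · rwa [eraseAt_of_ne J h]
  refine mem_filter.2 ⟨?_, hcard, fun h => hF' (hup _ _ ?_ ?_ h)⟩
  · by_cases h : i' = i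
    · subst h
      rw [eraseAt_self, mem_erase]
      refine ⟨?_, hl'J⟩
      rintro rfl
      exact hF' hFl
    · rwa [eraseAt_of_ne J h]
  · intro i''
    by_cases h : i'' = i'
    · subst h
      rw [eraseAt_self, ← card_pos]
      have := pred_card_le_card_erase (s := eraseAt J i l i'') (a := l')
      omega
    · rw [eraseAt_of_ne _ h]
      by_cases h' : i'' = i
      · subst h'
        rw [eraseAt_self, ← card_pos, card_erase_of_mem hl]
        omega
      · rw [eraseAt_of_ne _ h']
        exact hne i''
  · intro i''
    by_cases h : i'' = i'
    · subst h
      simp only [eraseAt_self]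
      exact erase_subset_erase _ (eraseAt_subset J i l i'')
    · rw [eraseAt_of_ne _ h, eraseAt_of_ne _ h]
      exact eraseAt_subset J i l i''

end Erase

variable [Fintype ι] [DecidableEq ι]

/-- The families of subsets `J' i ⊆ J i` of prescribed cardinalities. -/
def subfamilies (M : ι → ℕ) (J : ∀ i, Finset (α i)) : Finset (∀ i, Finset (α i)) :=
  Fintype.piFinset fun i => (J i).powersetCard (M i)

theorem mem_subfamilies {M : ι → ℕ} {J J' : ∀ i, Finset (α i)} :
    J' ∈ subfamilies M J ↔ ∀ i, J' i ⊆ J i ∧ #(J' i) = M i := by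
  simp [subfamilies, Fintype.mem_piFinset, mem_powersetCard]

theorem card_subfamilies (M : ι → ℕ) (J : ∀ i, Finset (α i)) :
    #(subfamilies M J) = ∏ i, (#(J i)).choose (M i) := by
  simp [subfamilies, Fintype.card_piFinset, card_powersetCard]

open Classical in
/-- The number of the families of prescribed cardinalities inside `J` that satisfy `F`. -/
noncomputable def goodCount (M : ι → ℕ) (J : ∀ i, Finset (α i)) : ℕ :=
  #{J' ∈ subfamilies M J | F J'}

variable {F} in
theorem goodCount_of_card_eq {M : ι → ℕ} {J : ∀ i, Finset (α i)} (hF : F J)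
    (hJ : ∀ i, #(J i) = M i) : 1 ≤ goodCount F M J := by
  classical
  exact card_pos.2 ⟨J, mem_filter.2 ⟨mem_subfamilies.2 fun i => ⟨Subset.rfl, hJ i⟩, hF⟩⟩

variable [∀ i, DecidableEq (α i)]

theorem mem_subfamilies_eraseAt {M : ι → ℕ} {J J' : ∀ i, Finset (α i)} {i : ι} {l : α i} :
    J' ∈ subfamilies M (eraseAt J i l) ↔ J' ∈ subfamilies M J ∧ l ∉ J' i := by
  simp only [mem_subfamilies]
  constructor
  · intro h
    refine ⟨fun i' => ⟨(h i').1.trans (eraseAt_subset J i l i'), (h i').2⟩, fun hl => ?_⟩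
    have := (h i).1 hl
    simp at this
  · rintro ⟨h, hl⟩ i'
    refine ⟨?_, (h i').2⟩
    by_cases hi : i' = i
    · subst hi
      rw [eraseAt_self]
      exact subset_erase.2 ⟨(h i').1, hl⟩
    · rw [eraseAt_of_ne J hi]
      exact (h i').1

/-- Double counting of pairs `(l, J')` with `l ∉ J'`: each good `J'` misses exactly `#(J i) - M i`
elements of `J i`. -/
theorem mul_goodCount (M : ι → ℕ) (J : ∀ i, Finset (α i)) (i : ι) :
    (#(J i) - M i) * goodCount F M J = ∑ l ∈ J i, goodCount F M (eraseAt J i l) := by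
  classical
  have h := sum_card_bipartiteAbove_eq_sum_card_bipartiteBelow
    (s := J i) (t := {J' ∈ subfamilies M J | F J'}) (fun l J' => l ∉ J' i)
  have h1 : ∀ l ∈ J i, #(bipartiteAbove (fun l (J' : ∀ i, Finset (α i)) => l ∉ J' i)
      {J' ∈ subfamilies M J | F J'} l) = goodCount F M (eraseAt J i l) := by
    intro l _
    unfold goodCount
    congr 1
    ext J'
    simp only [mem_bipartiteAbove, mem_filter, mem_subfamilies_eraseAt]
    tauto
  rw [sum_congr rfl h1] at h
  rw [h, sum_const_nat (m := #(J i) - M i), mul_comm]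
  · rfl
  · intro J' hJ'
    obtain ⟨hsub, hcard⟩ := mem_subfamilies.1 (mem_filter.1 hJ').1 i
    rw [← hcard, ← card_sdiff_of_subset hsub]
    congr 1
    ext l
    simp [mem_bipartiteBelow]

variable {F}

/-- Induction on the number of elements still to be deleted. In `mul_goodCount` only the inessential
`l` are kept. Essential sets persist along deletions, so the vector `k` found at the end of a chain
dominates all earlier essential counts. The hypothesis `K ≤ M i` guarantees that an inessential
element exists while a deletion is still needed. -/
theorem exists_prod_choose_le_goodCount {K : ℕ} {M : ι → ℕ} (hM : ∀ i, 0 < M i)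
    (hKM : ∀ i, K ≤ M i)
    (hup : ∀ J J' : ∀ i, Finset (α i), (∀ i, (J i).Nonempty) → (∀ i, J i ⊆ J' i) → F J → F J')
    (hK : ∀ J : ∀ i, Finset (α i), (∀ i, (J i).Nonempty) → F J → ∑ i, #(essential F J i) ≤ K)
    (J : ∀ i, Finset (α i)) (hF : F J) (hJ : ∀ i, M i ≤ #(J i)) :
    ∃ k : ι → ℕ, (∀ i, #(essential F J i) ≤ k i) ∧ ∑ i, k i ≤ K ∧
      ∏ i, (#(J i) - k i).choose (#(J i) - M i) ≤ goodCount F M J := by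
  classical
  induction hd : ∑ i, (#(J i) - M i) generalizing J with
  | zero =>
    have hz : ∀ i, #(J i) - M i = 0 := by simpa using hd
    refine ⟨fun i => #(essential F J i), fun i => le_rfl, hK J ?_ hF, ?_⟩
    · exact fun i => card_pos.1 ((hM i).trans_le (hJ i))
    · simp only [hz, Nat.choose_zero_right, prod_const_one]
      exact goodCount_of_card_eq hF fun i => le_antisymm (by have := hz i; omega) (hJ i)
  | succ d ih =>
    have hne : ∀ i, (J i).Nonempty := fun i => card_pos.1 ((hM i).trans_le (hJ i))
    by_cases hex : ∃ i, M i < #(J i) ∧ (#(J i) = 2 → essential F J i = ∅)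
    · obtain ⟨i, hi, hi2⟩ := hex
      have h1 : 1 < #(J i) := by have := hM i; omega
      have hrest : ∑ i' ∈ univ.erase i, (#(J i') - M i') + (#(J i) - M i) = d + 1 := by
        rw [sum_erase_add _ _ (mem_univ i), hd]
      have hE : essential F J i ⊆ J i := filter_subset _ _
      have hEK : #(essential F J i) ≤ K :=
        (single_le_sum (f := fun i => #(essential F J i)) (fun _ _ => Nat.zero_le _)
          (mem_univ i)).trans (hK J hne hF)
      have hnon : (J i \ essential F J i).Nonempty := by
        rw [← card_pos, card_sdiff_of_subset hE]
        have := hKM i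
        omega
      -- Different `l` may lead to different vectors `k`; taking the `l` with the smallest count
      -- lets a single `k` serve for the whole sum.
      obtain ⟨l, hl, hmin⟩ := exists_min_image _ (fun l => goodCount F M (eraseAt J i l)) hnon
      obtain ⟨hlJ, hlE⟩ := mem_sdiff.1 hl
      have hcard : #(eraseAt J i l i) = #(J i) - 1 := by
        rw [eraseAt_self, card_erase_of_mem hlJ]
      have hcard' : ∀ i', i' ≠ i → #(eraseAt J i l i') = #(J i') := fun i' h => by
        rw [eraseAt_of_ne J h]
      obtain ⟨k, hk, hkK, hprod⟩ := ih (eraseAt J i l)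
        (by by_contra h; exact hlE (mem_filter.2 ⟨hlJ, h1, h⟩))
        (by
          intro i'
          by_cases h : i' = i
          · subst h
            omega
          · rw [hcard' i' h]
            exact hJ i')
        (by
          rw [← sum_erase_add _ _ (mem_univ i), hcard,
            sum_congr rfl fun i' h => by rw [hcard' i' (ne_of_mem_erase h)]]
          omega)
      have hk' : ∀ i', #(essential F J i') ≤ k i' := fun i' =>
        (card_essential_le_eraseAt hup hne h1 hi2 hlJ hlE i').trans (hk i')
      refine ⟨k, hk', hkK, ?_⟩
      have hkiK : k i ≤ K := (single_le_sum (fun _ _ => Nat.zero_le _) (mem_univ i)).trans hkK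
      have hKMi := hKM i
      have hcount : (#(J i) - k i) * goodCount F M (eraseAt J i l) ≤
          (#(J i) - M i) * goodCount F M J := by
        rw [mul_goodCount F M J i]
        calc _ ≤ #(J i \ essential F J i) * goodCount F M (eraseAt J i l) := by
              gcongr
              rw [card_sdiff_of_subset hE]
              exact Nat.sub_le_sub_left (hk' i) _
          _ ≤ ∑ l' ∈ J i \ essential F J i, goodCount F M (eraseAt J i l') := by
              rw [← smul_eq_mul]
              exact card_nsmul_le_sum _ _ _ hmin
          _ ≤ _ := sum_le_sum_of_subset sdiff_subset
      have hpos : 0 < #(J i) - M i := by omega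
      have hothers : ∏ i' ∈ univ.erase i,
          (#(eraseAt J i l i') - k i').choose (#(eraseAt J i l i') - M i') =
          ∏ i' ∈ univ.erase i, (#(J i') - k i').choose (#(J i') - M i') :=
        prod_congr rfl fun i' h => by rw [hcard' i' (ne_of_mem_erase h)]
      refine Nat.le_of_mul_le_mul_left (le_trans (le_of_eq ?_)
        ((Nat.mul_le_mul_left (#(J i) - k i) hprod).trans hcount)) hpos
      rw [← mul_prod_erase univ _ (mem_univ i), ← mul_prod_erase univ _ (mem_univ i), hcard,
        hothers, ← mul_assoc, ← mul_assoc]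
      congr 1
      -- What remains is the absorption identity `(a + 1) * (a choose b) = (a + 1 choose b + 1) * (b
      -- + 1)`.
      obtain ⟨a, ha⟩ : ∃ a, #(J i) - k i = a + 1 := ⟨#(J i) - k i - 1, by omega⟩
      obtain ⟨b, hb⟩ : ∃ b, #(J i) - M i = b + 1 := ⟨#(J i) - M i - 1, by omega⟩
      rw [show #(J i) - 1 - k i = a by omega, show #(J i) - 1 - M i = b by omega, ha, hb,
        Nat.add_one_mul_choose_eq, mul_comm]
    -- Every group with a surplus now has two elements, one of them essential. Then `K ≤ M i = 1`
    -- leaves room for only one such group, and a single deletion finishes.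
    · push Not at hex
      obtain ⟨i, -, hi⟩ : ∃ i ∈ univ, #(J i) - M i ≠ 0 :=
        exists_ne_zero_of_sum_ne_zero (by rw [hd]; omega)
      obtain ⟨hi2, hiE⟩ := hex i (by omega)
      have hMi := hM i
      have hKMi := hKM i
      have hEi : 0 < #(essential F J i) := hiE.card_pos
      have hle : #(essential F J i) + ∑ i' ∈ univ.erase i, #(essential F J i') ≤ K := by
        rw [add_sum_erase univ (fun i => #(essential F J i)) (mem_univ i)]
        exact hK J hne hF
      have hzero : ∀ i', i' ≠ i → #(J i') - M i' = 0 := by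
        intro i' h
        by_contra h0
        have := card_pos.2 (hex i' (by omega)).2
        have := single_le_sum (f := fun i => #(essential F J i)) (fun _ _ => Nat.zero_le _)
          (mem_erase.2 ⟨h, mem_univ i'⟩)
        omega
      refine ⟨fun i => #(essential F J i), fun i => le_rfl, hK J hne hF, ?_⟩
      have hone : ∏ i', (#(J i') - #(essential F J i')).choose (#(J i') - M i') = 1 := by
        apply prod_eq_one
        intro i' _
        by_cases h : i' = i
        · subst h
          rw [show #(J i') - #(essential F J i') = 1 by omega, show #(J i') - M i' = 1 by omega,
            Nat.choose_self]
        · rw [hzero i' h, Nat.choose_zero_right]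
      rw [hone]
      obtain ⟨l, hlJ, hlE⟩ := exists_mem_notMem_of_card_lt_card
        (s := essential F J i) (t := J i) (by omega)
      have hFl : F (eraseAt J i l) := by
        by_contra h
        exact hlE (mem_filter.2 ⟨hlJ, by omega, h⟩)
      refine card_pos.2 ⟨eraseAt J i l, mem_filter.2 ⟨mem_subfamilies.2 fun i' =>
        ⟨eraseAt_subset J i l i', ?_⟩, hFl⟩⟩
      by_cases h : i' = i
      · subst h
        rw [eraseAt_self, card_erase_of_mem hlJ]
        omega
      · rw [eraseAt_of_ne J h]
        have := hzero i' h
        have := hJ i'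
        omega

end Subfamilies

/-! ### Comparison of binomial ratios -/

section Ratio

/-- A further draw without replacement, the first `j` having avoided `k` marked points out of `n`,
avoids them with probability `1 - k / (n - j)`. The next lemma gives the same recursion, with `k =
K`, for the ratio appearing in `psi`. -/
theorem choose_ratio_succ {n k j : ℕ} (hk : k ≤ n) (hj : j < n) :
    ((n - k).choose (j + 1) : ℝ) / (n.choose (j + 1) : ℝ) =
      (n - k).choose j / n.choose j * (1 - k / ((n : ℝ) - j)) := by
  have hn : ((n : ℝ) - j) ≠ 0 := by
    have : (j : ℝ) < n := by exact_mod_cast hj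
    linarith
  have h1 : (n.choose (j + 1) : ℝ) * (j + 1) = n.choose j * (n - j) := by
    rw [← Nat.cast_sub hj.le]
    exact_mod_cast Nat.choose_succ_right_eq n j
  have h2 : ((n - k).choose (j + 1) : ℝ) * (j + 1) = (n - k).choose j * (n - k - j) := by
    by_cases h : j ≤ n - k
    · rw [← Nat.cast_sub hk, ← Nat.cast_sub h]
      exact_mod_cast Nat.choose_succ_right_eq (n - k) j
    · rw [Nat.choose_eq_zero_of_lt (by omega : n - k < j + 1),
        Nat.choose_eq_zero_of_lt (by omega : n - k < j)]
      simp
  have p1 : (n.choose (j + 1) : ℝ) ≠ 0 := by exact_mod_cast (Nat.choose_pos (by omega)).ne'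
  have p2 : (n.choose j : ℝ) ≠ 0 := by exact_mod_cast (Nat.choose_pos hj.le).ne'
  have p3 : (j + 1 : ℝ) ≠ 0 := by positivity
  field_simp
  apply mul_right_cancel₀ p3
  linear_combination (n - j : ℝ) * n.choose j * h2 - ((n - k).choose j) * (n - k - j : ℝ) * h1

theorem choose_sub_ratio_succ {n K j : ℕ} (hj : j < n - K) :
    ((n - (j + 1)).choose K : ℝ) / (n.choose K : ℝ) =
      (n - j).choose K / n.choose K * (1 - K / ((n : ℝ) - j)) := by
  obtain ⟨a, rfl⟩ : ∃ a, n = a + 1 + j := ⟨n - j - 1, by omega⟩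
  have h := Nat.choose_mul_succ_eq a K
  have h' : (a.choose K : ℝ) * (a + 1) = (a + 1).choose K * (a + 1 - K) := by
    rw [← Nat.cast_one, ← Nat.cast_add, ← Nat.cast_sub (by omega)]
    exact_mod_cast h
  rw [show a + 1 + j - (j + 1) = a by omega, show a + 1 + j - j = a + 1 by omega]
  have p : ((a + 1 + j : ℕ) : ℝ) - j = a + 1 := by push_cast; ring
  have p3 : (a + 1 : ℝ) ≠ 0 := by positivity
  rw [p]
  field_simp
  rw [h']

theorem one_sub_sum_le_prod {ι : Type*} (s : Finset ι) (f : ι → ℝ) (h0 : ∀ i ∈ s, 0 ≤ f i)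
    (h1 : ∀ i ∈ s, f i ≤ 1) : 1 - ∑ i ∈ s, f i ≤ ∏ i ∈ s, (1 - f i) := by
  classical
  induction s using Finset.induction_on with
  | empty => simp
  | insert a s ha ih =>
    rw [sum_insert ha, prod_insert ha]
    have h := ih (fun i hi => h0 i (mem_insert_of_mem hi)) fun i hi => h1 i (mem_insert_of_mem hi)
    have ha0 := h0 a (mem_insert_self a s)
    have ha1 := h1 a (mem_insert_self a s)
    have hs : 0 ≤ ∑ i ∈ s, f i := sum_nonneg fun i hi => h0 i (mem_insert_of_mem hi)
    nlinarith [mul_le_mul_of_nonneg_left h (sub_nonneg.2 ha1), mul_nonneg ha0 hs]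

/-- Spreading the complexity over several larger datasets does not decrease the probability that
a random selection retains all the support scenarios. -/
theorem choose_ratio_le_prod {ι : Type*} [Fintype ι] {n K : ℕ} {N k : ι → ℕ}
    (hn : ∀ i, n ≤ N i) (hk : ∑ i, k i ≤ K) {j : ℕ} (hj : j ≤ n - K) :
    ((n - j).choose K : ℝ) / (n.choose K : ℝ) ≤
      ∏ i, ((N i - k i).choose j : ℝ) / ((N i).choose j : ℝ) := by
  induction j with
  -- Only an inequality: for `n < K` the left side is `0 / 0 = 0`.
  | zero => simpa using div_self_le_one (n.choose K : ℝ)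
  | succ j ih =>
    have hki : ∀ i, k i ≤ K := fun i =>
      (single_le_sum (fun _ _ => Nat.zero_le _) (mem_univ i)).trans hk
    have hjn : (0 : ℝ) < (n : ℝ) - j := by
      have : (j : ℝ) < n := by exact_mod_cast (show j < n by omega)
      linarith
    have hKn : (K : ℝ) ≤ n - j := by
      rw [← Nat.cast_sub (by omega)]
      exact_mod_cast (show K ≤ n - j by omega)
    have hkR : ∑ i, (k i : ℝ) ≤ K := by exact_mod_cast hk
    rw [choose_sub_ratio_succ (by omega), prod_congr rfl fun i _ => choose_ratio_succ
      (show k i ≤ N i by have := hki i; have := hn i; omega)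
      (show j < N i by have := hn i; omega), prod_mul_distrib]
    have hone : ∀ i, (k i : ℝ) / (n - j) ≤ 1 := fun i => by
      rw [div_le_one hjn]
      exact le_trans (by exact_mod_cast hki i) hKn
    refine mul_le_mul (ih (by omega)) ?_ (sub_nonneg.2 ((div_le_one hjn).2 hKn))
      (prod_nonneg fun i _ => by positivity)
    -- The recursion factors are compared one `j` at a time: `∑ k i ≤ K`, then Weierstrass' product
    -- inequality, then `n ≤ N i`.
    calc 1 - K / ((n : ℝ) - j) ≤ 1 - ∑ i, (k i : ℝ) / ((n : ℝ) - j) := by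
          rw [← sum_div]
          gcongr
      _ ≤ ∏ i, (1 - (k i : ℝ) / ((n : ℝ) - j)) :=
          one_sub_sum_le_prod _ _ (fun i _ => by positivity) fun i _ => hone i
      _ ≤ _ := by
          apply prod_le_prod
          · exact fun i _ => sub_nonneg.2 (hone i)
          · intro i _
            have : (n : ℝ) ≤ N i := by exact_mod_cast hn i
            gcongr

end Ratio

end MultiCriteria

namespace MultiCriteria

open Finset Function

/-! ### Selections of scenarios and the decisions they produce -/

section Selection

variable {m : ℕ} {Δ Z : Type*} {N : Fin m → ℕ}

/-- The datasets that consist of the selected scenarios only. -/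
noncomputable def select (x : (i : Fin m) → Fin (N i) → Δ) (J : ∀ i, Finset (Fin (N i))) :
    Fin m → List Δ :=
  fun i => (J i).toList.map (x i)

theorem select_ne_nil (x : (i : Fin m) → Fin (N i) → Δ) {J : ∀ i, Finset (Fin (N i))}
    (hJ : ∀ i, (J i).Nonempty) (i : Fin m) : select x J i ≠ [] := by
  simpa [select] using (hJ i).ne_empty

theorem select_perm_append (x : (i : Fin m) → Fin (N i) → Δ) {J J' : ∀ i, Finset (Fin (N i))}
    (h : ∀ i, J i ⊆ J' i) (i : Fin m) :
    (select x J' i).Perm (select x J i ++ select x (fun i => J' i \ J i) i) := by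
  unfold select
  rw [← List.map_append]
  refine List.Perm.map _ ?_
  rw [List.perm_ext_iff_of_nodup (nodup_toList _)]
  · intro l
    have := @h i l
    simp only [mem_toList, List.mem_append, mem_sdiff]
    tauto
  · refine List.Nodup.append (nodup_toList _) (nodup_toList _) ?_
    intro l hl hl'
    simp only [mem_toList, mem_sdiff] at hl hl'
    exact hl'.2 hl

theorem select_univ_perm (x : (i : Fin m) → Fin (N i) → Δ) (i : Fin m) :
    (select x (fun _ => univ) i).Perm (toLists x i) := by
  unfold select toLists
  rw [List.ofFn_eq_map]
  refine List.Perm.map _ ?_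
  rw [List.perm_ext_iff_of_nodup (nodup_toList _) (List.nodup_finRange _)]
  simp

variable {M : (Fin m → List Δ) → Z} {Zi : Fin m → Δ → Set Z}

/-- The decision is unaffected by additional scenarios exactly if they confirm it. -/
theorem IsConsistent.select_eq_iff (hM : IsConsistent M Zi) (x : (i : Fin m) → Fin (N i) → Δ)
    {J J' : ∀ i, Finset (Fin (N i))} (hJ : ∀ i, (J i).Nonempty) (h : ∀ i, J i ⊆ J' i) :
    M (select x J') = M (select x J) ↔
      ∀ i, ∀ l ∈ J' i \ J i, M (select x J) ∈ Zi i (x i l) := by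
  rw [hM.perm_invariant (fun i => select x J i ++ select x (fun i => J' i \ J i) i) _
    (fun i => by simp [select_ne_nil x hJ i]) (select_perm_append x h)]
  constructor
  · intro heq i l hl
    by_contra hc
    exact hM.responsive _ _ (select_ne_nil x hJ)
      ⟨i, x i l, List.mem_map.2 ⟨l, mem_toList.2 hl, rfl⟩, hc⟩ heq
  · intro hc
    refine hM.stable _ _ (select_ne_nil x hJ) fun i δ hδ => ?_
    obtain ⟨l, hl, rfl⟩ := List.mem_map.1 hδ
    exact hc i l (mem_toList.1 hl)

theorem IsConsistent.select_univ (hM : IsConsistent M Zi) (hN : ∀ i, 0 < N i)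
    (x : (i : Fin m) → Fin (N i) → Δ) : M (select x fun _ => univ) = M (toLists x) := by
  refine hM.perm_invariant _ _ (fun i => ?_) (select_univ_perm x)
  simp [toLists, (hN i).ne']

/-- The pivot of the proof: reproducing the full decision becomes a condition on the discarded
scenarios alone, once the selected ones are fixed. -/
theorem IsConsistent.eq_iff (hM : IsConsistent M Zi) (hN : ∀ i, 0 < N i)
    (x : (i : Fin m) → Fin (N i) → Δ) {J : ∀ i, Finset (Fin (N i))}
    (hJ : ∀ i, (J i).Nonempty) :
    M (select x J) = M (toLists x) ↔ ∀ i, ∀ l ∉ J i, M (select x J) ∈ Zi i (x i l) := by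
  rw [← hM.select_univ hN x, eq_comm,
    hM.select_eq_iff x (J' := fun _ => univ) hJ fun i => subset_univ _]
  simp

theorem remove_select_perm (x : (i : Fin m) → Fin (N i) → Δ) (J : ∀ i, Finset (Fin (N i)))
    (i : Fin m) (l : Fin (N i)) (i' : Fin m) :
    (remove (select x J) i ((J i).toList.idxOf l) i').Perm (select x (eraseAt J i l) i') := by
  unfold remove
  by_cases h : i' = i
  · subst h
    simp only [update_self, select, eraseAt_self]
    rw [List.eraseIdx_map, ← List.erase_eq_eraseIdx_of_idxOf rfl]
    refine List.Perm.map _ ?_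
    rw [List.perm_ext_iff_of_nodup ((nodup_toList _).erase _) (nodup_toList _)]
    intro a
    rw [(nodup_toList _).mem_erase_iff]
    simp
  · simp [update_of_ne h, select, eraseAt_of_ne J h]

theorem complexity_eq_card (D : Fin m → List Δ) (i : Fin m) [DecidablePred (IsSupport M D i)] :
    complexity M D i = #{j : Fin (D i).length | IsSupport M D i j} := by
  classical
  unfold complexity supportList
  rw [List.length_map, ← List.toFinset_card_of_nodup ((List.nodup_finRange _).filter _)]
  congr 1
  ext j
  simp

/-- The complexity bound covers all dataset lengths, so it also applies to the datasets formed by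
selections. -/
theorem HasComplexityAtMost.sum_le {K : ℕ} (hK : HasComplexityAtMost M K) {D : Fin m → List Δ}
    (hD : ∀ i, D i ≠ []) : ∑ i, complexity M D i ≤ K := by
  have h := hK (fun i => (D i).length) (fun i => List.length_pos_iff.2 (hD i)) fun i => (D i).get
  have e : toLists (fun i => (D i).get) = D := by
    funext i
    exact List.ofFn_get (D i)
  rwa [e] at h

/-- Deleting an essential index deletes a scenario whose removal changes the decision. The guard in
`essential` keeps the group nonempty, as permutation invariance requires. -/
theorem IsConsistent.card_essential_le (hM : IsConsistent M Zi)
    (x : (i : Fin m) → Fin (N i) → Δ) {J : ∀ i, Finset (Fin (N i))} (hJ : ∀ i, (J i).Nonempty)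
    {z : Z} (hz : M (select x J) = z) (i : Fin m) :
    #(essential (fun J => M (select x J) = z) J i) ≤ complexity M (select x J) i := by
  classical
  rw [complexity_eq_card]
  have hlen : ∀ l ∈ J i, (J i).toList.idxOf l < (select x J i).length := fun l hl => by
    simpa [select] using List.idxOf_lt_length_of_mem (mem_toList.2 hl)
  have hmem : ∀ l ∈ essential (fun J => M (select x J) = z) J i, l ∈ J i :=
    fun l hl => (mem_filter.1 hl).1
  -- An index is sent to its position in the list; the position 0 is a dummy value, never used on
  -- essential indices.
  refine card_le_card_of_injOn
    (fun l => if hl : l ∈ J i then ⟨(J i).toList.idxOf l, hlen l hl⟩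
      else ⟨0, List.length_pos_iff.2 (select_ne_nil x hJ i)⟩) ?_ ?_
  · intro l hl
    obtain ⟨hlJ, h1, hne⟩ := mem_filter.1 hl
    simp only [hlJ, dite_true, coe_filter, mem_univ, true_and, Set.mem_ofPred_eq]
    unfold IsSupport
    rw [hz, hM.perm_invariant (select x (eraseAt J i l)) _ (select_ne_nil x fun i' => ?_)
      (remove_select_perm x J i l)]
    · exact hne
    · by_cases h : i' = i
      · subst h
        rw [eraseAt_self, ← card_pos, card_erase_of_mem hlJ]
        omega
      · rw [eraseAt_of_ne J h]
        exact hJ i'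
  · intro l hl l' hl' heq
    simp only [hmem l hl, hmem l' hl', dite_true, Fin.mk.injEq] at heq
    exact (List.idxOf_inj (mem_toList.2 (hmem l hl))).1 heq

/-- At least the fraction `(n - j choose K) / (n choose K)` of the selections that discard `j`
scenarios for each criterion give back the decision. -/
theorem IsConsistent.ratio_mul_le_goodCount (hM : IsConsistent M Zi) {K : ℕ}
    (hK : HasComplexityAtMost M K) {n j : ℕ} (hn : ∀ i, n ≤ N i) (hj : j ≤ n - K) (hjn : j < n)
    (x : (i : Fin m) → Fin (N i) → Δ) :
    ((n - j).choose K : ℝ) / (n.choose K : ℝ) *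
        #(subfamilies (fun i => N i - j) fun i => (univ : Finset (Fin (N i)))) ≤
      goodCount (fun J => M (select x J) = M (toLists x)) (fun i => N i - j) fun _ => univ := by
  have hKn : K ≤ n ∨ n < K := le_or_gt _ _
  rcases hKn with hKn | hKn
  swap
  · rw [Nat.choose_eq_zero_of_lt hKn]
    simp
  obtain ⟨k, -, hk, hprod⟩ := exists_prod_choose_le_goodCount (K := K)
    (F := fun J => M (select x J) = M (toLists x)) (M := fun i => N i - j)
    (fun i => by have := hn i; omega) (fun i => by have := hn i; omega)
    -- Upward closure: if `J` reproduces the decision, all discarded scenarios confirm it, so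
    -- restoring some of them changes nothing.
    (fun J J' hJ hJJ' h => by
      rw [← h]
      refine (hM.select_eq_iff x hJ hJJ').2 fun i l hl => ?_
      exact (hM.eq_iff (fun i => by have := hn i; omega) x hJ).1 h i l (mem_sdiff.1 hl).2)
    (fun J hJ h => (sum_le_sum fun i _ => hM.card_essential_le x hJ h i).trans
      (hK.sum_le (select_ne_nil x hJ)))
    (fun _ => univ) (hM.select_univ (fun i => by have := hn i; omega) x) (fun i => by simp)
  have hr := choose_ratio_le_prod hn hk hj
  have hjN : ∀ i, N i - (N i - j) = j := fun i => by have := hn i; omega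
  simp only [card_univ, Fintype.card_fin, hjN] at hprod
  rw [card_subfamilies]
  simp only [card_univ, Fintype.card_fin]
  have hsymm : ∀ i, (N i).choose (N i - j) = (N i).choose j := fun i =>
    Nat.choose_symm (by have := hn i; omega)
  simp only [hsymm]
  push_cast
  calc _ ≤ (∏ i, ((N i - k i).choose j : ℝ) / ((N i).choose j : ℝ)) *
        ∏ i, ((N i).choose j : ℝ) := by gcongr
    _ = ∏ i, ((N i - k i).choose j : ℝ) := by
        rw [← prod_mul_distrib]
        refine prod_congr rfl fun i _ => div_mul_cancel₀ _ ?_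
        exact_mod_cast (Nat.choose_pos (by have := hn i; omega)).ne'
    _ ≤ _ := by exact_mod_cast hprod

/-- If no dataset has a support scenario, every scenario confirms every decision. -/
theorem IsConsistent.mem_of_hasComplexityAtMost_zero (hM : IsConsistent M Zi)
    (hK : HasComplexityAtMost M 0) {D : Fin m → List Δ} (hD : ∀ i, D i ≠ []) (i : Fin m)
    (δ : Δ) : M D ∈ Zi i δ := by
  classical
  by_contra hc
  set E : Fin m → List Δ := fun i' => if i' = i then [δ] else [] with hE
  refine hM.responsive D E hD ⟨i, δ, by simp [hE], hc⟩ ?_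
  have h0 := hK.sum_le (D := fun i => D i ++ E i) fun i => by simp [hD i]
  have h1 : complexity M (fun i => D i ++ E i) i = 0 := by
    have := single_le_sum (f := fun i' => complexity M (fun i => D i ++ E i) i')
      (fun _ _ => Nat.zero_le _) (mem_univ i)
    exact Nat.le_zero.1 (this.trans h0)
  rw [complexity_eq_card, card_eq_zero, filter_eq_empty_iff] at h1
  -- The appended `δ` occupies position `(D i).length`. It is not a support scenario, so its
  -- removal, which restores `D`, keeps the decision, against responsiveness.
  have h2 := h1 (mem_univ ⟨(D i).length, by simp [hE]⟩)
  unfold IsSupport at h2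
  rw [not_not] at h2
  rw [← h2]
  congr 1
  funext i'
  unfold remove
  by_cases h : i' = i
  · subst h
    simp [hE, List.eraseIdx_append_of_length_le]
  · simp [hE, h]

end Selection

end MultiCriteria

namespace MultiCriteria

open Finset Function MeasureTheory
open scoped ENNReal

/-! ### Negative moments of the confirmation probability and the risk bound -/

section Measure

variable {m : ℕ} {Δ Z : Type*} {N : Fin m → ℕ}

/-- The selected scenarios, listed in increasing order of their indices. -/
def restrict (J : ∀ i, Finset (Fin (N i))) (x : (i : Fin m) → Fin (N i) → Δ) :
    (i : Fin m) → Fin #(J i) → Δ :=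
  fun i k => x i ((J i).orderEmbOfFin rfl k)

theorem toLists_restrict_perm (J : ∀ i, Finset (Fin (N i))) (x : (i : Fin m) → Fin (N i) → Δ)
    (i : Fin m) : (toLists (restrict J x) i).Perm (select x J i) := by
  have h : toLists (restrict J x) i = (List.ofFn ((J i).orderEmbOfFin rfl)).map (x i) := by
    simp only [toLists, List.map_ofFn]
    rfl
  rw [h, select]
  refine List.Perm.map _ ?_
  rw [List.perm_ext_iff_of_nodup
    (List.nodup_ofFn.2 ((J i).orderEmbOfFin rfl).injective) (nodup_toList _)]
  intro l
  rw [List.mem_ofFn, mem_toList, ← mem_coe, ← range_orderEmbOfFin (J i) rfl, Set.mem_range]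

variable {M : (Fin m → List Δ) → Z} {Zi : Fin m → Δ → Set Z}

theorem IsConsistent.apply_toLists_restrict (hM : IsConsistent M Zi)
    {J : ∀ i, Finset (Fin (N i))} (hJ : ∀ i, (J i).Nonempty)
    (x : (i : Fin m) → Fin (N i) → Δ) : M (toLists (restrict J x)) = M (select x J) :=
  hM.perm_invariant _ _ (select_ne_nil x hJ) (toLists_restrict_perm J x)

variable [MeasurableSpace Δ]

theorem measurable_restrict (J : ∀ i, Finset (Fin (N i))) :
    Measurable (restrict J : ((i : Fin m) → Fin (N i) → Δ) → _) := by
  unfold restrict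
  fun_prop

/-- The probability that `m` independent scenarios, one for each criterion, confirm `z`. -/
noncomputable def confirmProb (P : Measure Δ) (Zi : Fin m → Δ → Set Z) (z : Z) : ℝ≥0∞ :=
  ∏ i, P {δ | z ∈ Zi i δ}

theorem IsMeasurableScheme.measurable_confirmProb (hmeas : IsMeasurableScheme M Zi)
    (P : Measure Δ) [IsProbabilityMeasure P] (hN : ∀ i, 0 < N i) :
    Measurable fun x : (i : Fin m) → Fin (N i) → Δ => confirmProb P Zi (M (toLists x)) := by
  unfold confirmProb
  exact Finset.measurable_fun_prod _ fun i _ => measurable_measure_prodMk_left (hmeas N hN i)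

theorem IsMeasurableScheme.measurableSet_section (hmeas : IsMeasurableScheme M Zi)
    (hN : ∀ i, 0 < N i) (x : (i : Fin m) → Fin (N i) → Δ) (i : Fin m) :
    MeasurableSet {δ | M (toLists x) ∈ Zi i δ} :=
  measurable_prodMk_left (hmeas N hN i)

/-- `Z` carries no measurable structure, so measurability comes from rewriting the event, by
`eq_iff`, as a finite intersection of confirmation events. -/
theorem measurableSet_select_eq (hmeas : IsMeasurableScheme M Zi) (hM : IsConsistent M Zi)
    (hN : ∀ i, 0 < N i) {J : ∀ i, Finset (Fin (N i))} (hJ : ∀ i, (J i).Nonempty) :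
    MeasurableSet {x : (i : Fin m) → Fin (N i) → Δ | M (select x J) = M (toLists x)} := by
  have h : {x : (i : Fin m) → Fin (N i) → Δ | M (select x J) = M (toLists x)} =
      ⋂ i, ⋂ l, ⋂ (_ : l ∉ J i), (fun x => (restrict J x, x i l)) ⁻¹'
        {p : ((i : Fin m) → Fin #(J i) → Δ) × Δ | M (toLists p.1) ∈ Zi i p.2} := by
    ext x
    simp only [Set.mem_ofPred_eq, Set.mem_iInter, Set.mem_preimage, hM.eq_iff hN x hJ,
      hM.apply_toLists_restrict hJ]
  rw [h]
  refine MeasurableSet.iInter fun i => MeasurableSet.iInter fun l => MeasurableSet.iInter fun _ =>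
    ?_
  exact ((measurable_restrict J).prodMk (by fun_prop)) (hmeas _ (fun i => (hJ i).card_pos) i)

/-- Flattens the iterated product into one over index pairs, where selected and discarded
coordinates can be separated at once. -/
theorem map_piCurry_pi (P : Measure Δ) [IsProbabilityMeasure P] :
    (Measure.pi fun _ : (i : Fin m) × Fin (N i) => P).map
      (MeasurableEquiv.piCurry fun _ _ => Δ) = dataLaw P N := by
  have h := Measure.infinitePi_map_piCurry (X := fun (i : Fin m) (_ : Fin (N i)) => Δ)
    fun _ _ => P
  simpa [Measure.infinitePi_eq_pi, dataLaw] using h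

/-- A selection is confirmed by the `j` discarded scenarios of each criterion with probability at
most `confirmProb ^ j`, conditionally on the selected scenarios. -/
theorem lintegral_indicator_confirmProb_le (hM : IsConsistent M Zi) (P : Measure Δ)
    [IsProbabilityMeasure P] (hN : ∀ i, 0 < N i) {J : ∀ i, Finset (Fin (N i))}
    (hJ : ∀ i, (J i).Nonempty) {j : ℕ} (hj : ∀ i, #(J i)ᶜ = j) :
    ∫⁻ x, {x | M (select x J) = M (toLists x)}.indicator
      (fun x => (confirmProb P Zi (M (toLists x)))⁻¹ ^ j) x ∂(dataLaw P N) ≤ 1 := by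
  classical
  set p : ((i : Fin m) × Fin (N i)) → Prop := fun q => q.2 ∈ J q.1 with hp
  set e := MeasurableEquiv.piEquivPiSubtypeProd (fun _ : (i : Fin m) × Fin (N i) => Δ) p with he
  have hsplit := (measurePreserving_piEquivPiSubtypeProd
    (fun _ : (i : Fin m) × Fin (N i) => P) p).symm.map_eq
  rw [← map_piCurry_pi, lintegral_map_equiv, ← hsplit, lintegral_map_equiv]
  -- This direction of Tonelli needs no measurability of the integrand.
  refine (lintegral_prod_le _).trans ?_
  -- Fixing the selected coordinates `y` fixes the decision `z`; as a function of the discarded ones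
  -- `w`, the integrand is then a constant on a box.
  have key : ∀ y : {q // p q} → Δ, ∃ z : Z, ∀ w : {q // ¬ p q} → Δ,
      {x | M (select x J) = M (toLists x)}.indicator
        (fun x => (confirmProb P Zi (M (toLists x)))⁻¹ ^ j)
        (MeasurableEquiv.piCurry (fun _ _ => Δ) (e.symm (y, w))) =
      (Set.univ.pi fun q : {q // ¬ p q} => {δ | z ∈ Zi q.1.1 δ}).indicator
        (fun _ => (confirmProb P Zi z)⁻¹ ^ j) w := by
    intro y
    have hin : ∀ (w : {q // ¬ p q} → Δ) i l (h : l ∈ J i),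
        MeasurableEquiv.piCurry (fun _ _ => Δ) (e.symm (y, w)) i l = y ⟨⟨i, l⟩, h⟩ := by
      intro w i l h
      simp [he, MeasurableEquiv.piEquivPiSubtypeProd, Equiv.piEquivPiSubtypeProd,
        Sigma.curry, hp, h]
    have hout : ∀ (w : {q // ¬ p q} → Δ) i l (h : l ∉ J i),
        MeasurableEquiv.piCurry (fun _ _ => Δ) (e.symm (y, w)) i l = w ⟨⟨i, l⟩, h⟩ := by
      intro w i l h
      simp [he, MeasurableEquiv.piEquivPiSubtypeProd, Equiv.piEquivPiSubtypeProd,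
        Sigma.curry, hp, h]
    refine ⟨M (toLists fun i k => y ⟨⟨i, (J i).orderEmbOfFin rfl k⟩,
      orderEmbOfFin_mem (J i) rfl k⟩), fun w => ?_⟩
    set x := MeasurableEquiv.piCurry (fun _ _ => Δ) (e.symm (y, w)) with hx
    have hr : restrict J x = fun i k => y ⟨⟨i, (J i).orderEmbOfFin rfl k⟩,
        orderEmbOfFin_mem (J i) rfl k⟩ := by
      funext i k
      exact hin w i _ _
    rw [← hr, hM.apply_toLists_restrict hJ]
    have hiff : M (select x J) = M (toLists x) ↔
        w ∈ Set.univ.pi fun q : {q // ¬ p q} => {δ | M (select x J) ∈ Zi q.1.1 δ} := by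
      rw [hM.eq_iff hN x hJ]
      simp only [Set.mem_pi, Set.mem_univ, true_imp_iff, Set.mem_ofPred_eq, Subtype.forall,
        Sigma.forall]
      refine forall_congr' fun i => forall_congr' fun l => forall_congr' fun h => ?_
      rw [hx, hout w i l h]
    by_cases h : M (select x J) = M (toLists x)
    · rw [Set.indicator_of_mem (by exact h), Set.indicator_of_mem (hiff.1 h), h]
    · rw [Set.indicator_of_notMem (by exact h), Set.indicator_of_notMem (fun h' => h (hiff.2 h'))]
  refine (lintegral_mono (g := fun _ => 1) fun y => ?_).trans (by simp)
  obtain ⟨z, hz⟩ := key y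
  refine (lintegral_congr hz).trans_le ((lintegral_indicator_const_le _ _).trans ?_)
  have hprod : ∏ q : {q // ¬ p q}, P {δ | z ∈ Zi q.1.1 δ} = confirmProb P Zi z ^ j := by
    rw [confirmProb, ← prod_pow]
    rw [← prod_subtype (univ.sigma fun i => (J i)ᶜ) (p := fun q => ¬ p q)
      (by simp [hp]) (fun q : (i : Fin m) × Fin (N i) => P {δ | z ∈ Zi q.1 δ}), prod_sigma]
    refine prod_congr rfl fun i _ => ?_
    simp only [prod_const, hj i]
  rw [Measure.pi_pi, hprod, ← mul_pow]
  -- Valid also for confirmation probability 0, since `⊤ * 0 = 0`.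
  exact pow_le_one' (ENNReal.inv_mul_le_one _) j

/-- Sum over all selections: each sample is counted at least `ratio * #fam` times, while each
selection contributes at most 1 to the integral. -/
theorem ratio_mul_lintegral_le_one (hmeas : IsMeasurableScheme M Zi) (hM : IsConsistent M Zi)
    (P : Measure Δ) [IsProbabilityMeasure P] {K : ℕ} (hK : HasComplexityAtMost M K) {n j : ℕ}
    (hn : ∀ i, n ≤ N i) (hj : j ≤ n - K) (hjn : j < n) :
    ENNReal.ofReal (((n - j).choose K : ℝ) / (n.choose K : ℝ)) *
      ∫⁻ x, (confirmProb P Zi (M (toLists x)))⁻¹ ^ j ∂(dataLaw P N) ≤ 1 := by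
  classical
  have hN : ∀ i, 0 < N i := fun i => by have := hn i; omega
  set fam := subfamilies (fun i => N i - j) fun i => (univ : Finset (Fin (N i))) with hfam
  have hmem : ∀ J ∈ fam, ∀ i, #(J i) = N i - j := fun J hJ i => (mem_subfamilies.1 hJ i).2
  have hne : ∀ J ∈ fam, ∀ i, (J i).Nonempty := fun J hJ i => by
    rw [← card_pos, hmem J hJ i]
    have := hn i
    omega
  have hmeasT := hmeas.measurable_confirmProb P hN
  have hpos : #fam ≠ 0 := by
    rw [hfam, card_subfamilies]
    refine prod_ne_zero_iff.2 fun i _ => (Nat.choose_pos ?_).ne'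
    simp
  have hpt : ∀ x : (i : Fin m) → Fin (N i) → Δ,
      (#fam : ℝ≥0∞) * (ENNReal.ofReal (((n - j).choose K : ℝ) / (n.choose K : ℝ)) *
        (confirmProb P Zi (M (toLists x)))⁻¹ ^ j) ≤
      ∑ J ∈ fam, {x | M (select x J) = M (toLists x)}.indicator
        (fun x => (confirmProb P Zi (M (toLists x)))⁻¹ ^ j) x := by
    intro x
    have hcount := hM.ratio_mul_le_goodCount hK hn hj hjn x
    rw [← hfam] at hcount
    simp only [Set.indicator_apply, Set.mem_ofPred_eq]
    rw [← sum_filter, sum_const, nsmul_eq_mul, ← mul_assoc]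
    gcongr
    have h := ENNReal.ofReal_le_ofReal hcount
    rw [ENNReal.ofReal_mul (by positivity), ENNReal.ofReal_natCast, ENNReal.ofReal_natCast,
      mul_comm] at h
    refine h.trans (le_of_eq ?_)
    congr 2
  have hint := lintegral_mono (μ := dataLaw P N) hpt
  rw [lintegral_const_mul _ (by fun_prop), lintegral_const_mul _ (by fun_prop),
    lintegral_finsetSum _ fun J hJ => Measurable.indicator (by fun_prop)
      (measurableSet_select_eq hmeas hM hN (hne J hJ))] at hint
  have hsum : ∑ J ∈ fam, ∫⁻ x, {x | M (select x J) = M (toLists x)}.indicator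
      (fun x => (confirmProb P Zi (M (toLists x)))⁻¹ ^ j) x ∂(dataLaw P N) ≤ #fam := by
    calc _ ≤ ∑ J ∈ fam, (1 : ℝ≥0∞) := sum_le_sum fun J hJ =>
          lintegral_indicator_confirmProb_le hM P hN (hne J hJ) fun i => by
            rw [card_compl, hmem J hJ i, Fintype.card_fin]
            have := hn i
            omega
      _ = #fam := by simp
  have h := hint.trans hsum
  refine (ENNReal.mul_le_mul_iff_right (a := (#fam : ℝ≥0∞)) (by exact_mod_cast hpos)
    (ENNReal.natCast_ne_top _)).1 ?_
  rwa [mul_one]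

/-- The union bound for `V` and `1 - u ≤ exp (-u)` for each factor; the number of criteria cancels
out. -/
theorem confirmProb_le_exp_neg_jointRisk (hmeas : IsMeasurableScheme M Zi) (P : Measure Δ)
    [IsProbabilityMeasure P] (hN : ∀ i, 0 < N i) (x : (i : Fin m) → Fin (N i) → Δ) :
    confirmProb P Zi (M (toLists x)) ≤
      ENNReal.ofReal (Real.exp (-jointRisk P Zi (M (toLists x)))) := by
  set z := M (toLists x)
  have hs : ∀ i, MeasurableSet {δ | z ∈ Zi i δ} := hmeas.measurableSet_section hN x
  have hconf : confirmProb P Zi z = ENNReal.ofReal (∏ i, P.real {δ | z ∈ Zi i δ}) := by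
    rw [ENNReal.ofReal_prod_of_nonneg fun i _ => measureReal_nonneg]
    simp [confirmProb]
  rw [hconf]
  apply ENNReal.ofReal_le_ofReal
  have hV : jointRisk P Zi z ≤ ∑ i, (1 - P.real {δ | z ∈ Zi i δ}) := by
    unfold jointRisk
    have h : {δ | ∃ i, z ∉ Zi i δ} = ⋃ i, {δ | z ∈ Zi i δ}ᶜ := by
      ext δ
      simp
    rw [h]
    refine (measureReal_iUnion_fintype_le _).trans (le_of_eq (sum_congr rfl fun i _ => ?_))
    rw [probReal_compl_eq_one_sub (hs i)]
  calc ∏ i, P.real {δ | z ∈ Zi i δ}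
      ≤ ∏ i, Real.exp (-(1 - P.real {δ | z ∈ Zi i δ})) := by
        refine prod_le_prod (fun i _ => measureReal_nonneg) fun i _ => ?_
        have := Real.add_one_le_exp (-(1 - P.real {δ | z ∈ Zi i δ}))
        linarith
    _ = Real.exp (-∑ i, (1 - P.real {δ | z ∈ Zi i δ})) := by
        rw [← Real.exp_sum, sum_neg_distrib]
    _ ≤ _ := Real.exp_le_exp.2 (neg_le_neg hV)

/-- Markov's inequality for `f`, a decreasing function of the confirmation probability whose value
at `t` is `n / β` by the choice of `t`. Positivity of `K` keeps `j ≤ n - K` below `n`, so no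
selection is empty. -/
theorem measure_confirmProb_lt_le (hmeas : IsMeasurableScheme M Zi) (hM : IsConsistent M Zi)
    (P : Measure Δ) [IsProbabilityMeasure P] {K : ℕ} (hK : HasComplexityAtMost M K) {n : ℕ}
    (hn : ∀ i, n ≤ N i) (hK0 : 0 < K) (hKn : K < n) {β : ℝ} (hβ : 0 < β) {t : ℝ} (ht : 0 < t)
    (hψ : psi β K n t = 0) :
    dataLaw P N {x | confirmProb P Zi (M (toLists x)) < ENNReal.ofReal t} ≤
      ENNReal.ofReal β := by
  have hN : ∀ i, 0 < N i := fun i => by have := hn i; omega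
  have hn0 : (0 : ℝ) < n := by exact_mod_cast (show 0 < n by omega)
  have hmeasT := hmeas.measurable_confirmProb P hN
  set r : ℕ → ℝ := fun j => ((n - j).choose K : ℝ) / (n.choose K : ℝ) with hr
  have hr0 : ∀ j, 0 ≤ r j := fun j => by positivity
  have hsum : ∑ j ∈ Icc 1 (n - K), r j * t⁻¹ ^ j = n / β := by
    unfold psi at hψ
    have h : ∑ j ∈ Icc 1 (n - K), r j * t ^ (-(j : ℤ)) = n / β := by
      change 1 - β / n * ∑ j ∈ Icc 1 (n - K), r j * t ^ (-(j : ℤ)) = 0 at hψ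
      rw [eq_div_iff hβ.ne']
      rw [sub_eq_zero, eq_comm, div_mul_eq_mul_div, div_eq_one_iff_eq hn0.ne'] at hψ
      rw [mul_comm, hψ]
    rw [← h]
    refine sum_congr rfl fun j _ => ?_
    rw [zpow_neg, zpow_natCast, inv_pow]
  set f : ((i : Fin m) → Fin (N i) → Δ) → ℝ≥0∞ := fun x => ∑ j ∈ Icc 1 (n - K),
    ENNReal.ofReal (r j) * (confirmProb P Zi (M (toLists x)))⁻¹ ^ j with hf
  have hfm : Measurable f := by fun_prop
  -- There are `n - K` terms of integral at most 1; the cruder bound `n` is the normalisation in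
  -- `psi`.
  have hint : ∫⁻ x, f x ∂(dataLaw P N) ≤ n := by
    rw [hf, lintegral_finsetSum _ fun j _ => by fun_prop]
    calc _ ≤ ∑ j ∈ Icc 1 (n - K), (1 : ℝ≥0∞) := by
          refine sum_le_sum fun j hj => ?_
          rw [mem_Icc] at hj
          rw [lintegral_const_mul _ (by fun_prop)]
          exact ratio_mul_lintegral_le_one hmeas hM P hK hn hj.2 (by omega)
      _ ≤ n := by
          simp only [sum_const, Nat.card_Icc, nsmul_eq_mul, mul_one]
          exact_mod_cast (show n - K + 1 - 1 ≤ n by omega)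
  have hsub : {x : (i : Fin m) → Fin (N i) → Δ |
      confirmProb P Zi (M (toLists x)) < ENNReal.ofReal t} ⊆
      {x | ENNReal.ofReal (n / β) ≤ f x} := by
    intro x hx
    simp only [Set.mem_ofPred_eq] at hx ⊢
    rw [← hsum, ENNReal.ofReal_sum_of_nonneg fun j _ => mul_nonneg (hr0 j) (by positivity)]
    refine sum_le_sum fun j _ => ?_
    rw [ENNReal.ofReal_mul (hr0 j), ENNReal.ofReal_pow (by positivity),
      ENNReal.ofReal_inv_of_pos ht]
    gcongr
  have hmarkov := (mul_meas_ge_le_lintegral (μ := dataLaw P N) hfm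
    (ENNReal.ofReal (n / β))).trans hint
  have hc : (n : ℝ≥0∞) = ENNReal.ofReal (n / β) * ENNReal.ofReal β := by
    rw [← ENNReal.ofReal_mul (by positivity), div_mul_cancel₀ _ hβ.ne', ENNReal.ofReal_natCast]
  rw [hc] at hmarkov
  refine (measure_mono hsub).trans ((ENNReal.mul_le_mul_iff_right ?_ ENNReal.ofReal_ne_top).1
    hmarkov)
  simpa using div_pos hn0 hβ

instance isProbabilityMeasure_dataLaw (P : Measure Δ) [IsProbabilityMeasure P] :
    IsProbabilityMeasure (dataLaw P N) := by
  unfold dataLaw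
  infer_instance

end Measure

end MultiCriteria

theorem proposition4 {Δ Z : Type*} [MeasurableSpace Δ]
    (P : MeasureTheory.Measure Δ) [MeasureTheory.IsProbabilityMeasure P]
    {m : ℕ} (hm : 0 < m)
    (Zi : Fin m → Δ → Set Z) (M : (Fin m → List Δ) → Z)
    (hmeas : MultiCriteria.IsMeasurableScheme M Zi)
    (hcons : MultiCriteria.IsConsistent M Zi)
    (hnd : MultiCriteria.IsNonDegenerate P M)
    (K : ℕ) (hK : MultiCriteria.HasComplexityAtMost M K)
    (N : Fin m → ℕ) (hN : ∀ i, 0 < N i)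
    (β : ℝ) (hβ0 : 0 < β) (hβ1 : β < 1) :
    1 - β ≤ (MultiCriteria.dataLaw P N).real
      {x | MultiCriteria.jointRisk P Zi (M (MultiCriteria.toLists x)) ≤
        MultiCriteria.logBound (MultiCriteria.tbar β K (⨅ i, N i))} := by
  open MultiCriteria MeasureTheory in
  set n := ⨅ i, N i with hn
  have hnN : ∀ i, n ≤ N i := fun i => ciInf_le' N i
  have hV1 : ∀ z, jointRisk P Zi z ≤ 1 := fun z => measureReal_le_one
  have hall : (∀ x : (i : Fin m) → Fin (N i) → Δ,
      jointRisk P Zi (M (toLists x)) ≤ logBound (tbar β K n)) →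
      1 - β ≤ (dataLaw P N).real
        {x | jointRisk P Zi (M (toLists x)) ≤ logBound (tbar β K n)} := fun h => by
    rw [Set.eq_univ_of_forall (s := {x : (i : Fin m) → Fin (N i) → Δ |
      jointRisk P Zi (M (toLists x)) ≤ logBound (tbar β K n)}) h, probReal_univ]
    linarith
  by_cases hKn : K < n
  swap
  · refine hall fun x => ?_
    simp [tbar, hKn, logBound, hV1]
  obtain ⟨ht, hψ, -⟩ := tbar_spec hβ0 hβ1 hKn
  set t := tbar β K n with ht_def
  have hlog : logBound t = min (Real.log (1 / t)) 1 := if_neg ht.1.ne'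
  -- For `K = 0` the moment of order `n` could require discarding a whole dataset; but then no
  -- decision is ever contradicted and the risk is 0.
  rcases Nat.eq_zero_or_pos K with rfl | hK0
  · refine hall fun x => ?_
    have h0 : jointRisk P Zi (M (toLists x)) = 0 := by
      have : {δ | ∃ i, M (toLists x) ∉ Zi i δ} = ∅ := by
        refine Set.eq_empty_of_forall_notMem fun δ ⟨i, hi⟩ => hi ?_
        exact hcons.mem_of_hasComplexityAtMost_zero hK
          (fun i => by simp [toLists, (hN i).ne']) i δ
      simp [jointRisk, this]
    rw [h0, hlog]
    exact le_min (Real.log_nonneg ((one_le_div ht.1).2 ht.2.le)) zero_le_one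
  have hbad := measure_confirmProb_lt_le hmeas hcons P hK hnN hK0 hKn hβ0 ht.1 hψ
  set good := {x : (i : Fin m) → Fin (N i) → Δ |
    jointRisk P Zi (M (toLists x)) ≤ logBound t}
  have hcover : goodᶜ ⊆ {x : (i : Fin m) → Fin (N i) → Δ |
      confirmProb P Zi (M (toLists x)) < ENNReal.ofReal t} := by
    intro x hx
    -- The risk never exceeds 1, so only the logarithm in the minimum can be violated.
    have hx' : Real.log (1 / t) < jointRisk P Zi (M (toLists x)) := by
      by_contra h
      refine hx ?_
      change _ ≤ logBound t
      rw [hlog]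
      exact le_min (not_lt.1 h) (hV1 _)
    refine (confirmProb_le_exp_neg_jointRisk hmeas P hN x).trans_lt ?_
    rw [ENNReal.ofReal_lt_ofReal_iff ht.1, ← Real.lt_log_iff_exp_lt ht.1]
    rw [one_div, Real.log_inv] at hx'
    linarith
  have hbadR : (dataLaw P N).real goodᶜ ≤ β :=
    ENNReal.toReal_le_of_le_ofReal hβ0.le ((measure_mono hcover).trans hbad)
  -- Subadditivity suffices, so `good` need not be measurable.
  have hone : 1 ≤ (dataLaw P N).real good + (dataLaw P N).real goodᶜ := by
    rw [← probReal_univ (μ := dataLaw P N), ← Set.union_compl_self good]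
    exact measureReal_union_le _ _
  linarith
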